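/- Let $X\subseteq\mathbb R^N$ be an open set with coordinates $x^1,\dots,x^N$ and volume form $\Omega_0=dx^1\wedge\dots\wedge dx^N$ (Lebesgue measure). Let $\mathfrak g$ be a finite-dimensional real Lie algebra with basis $(e_\alpha)_{1\le\alpha\le r}$ and structure constants $[e_\alpha,e_\beta]=C_{\alpha\beta}^\gamma e_\gamma$, acting on $X$ through a homomorphism of Lie algebras $\rho$ from $\mathfrak g$ to the smooth vector fields on $X$, $\rho(e_\alpha)=\rho_\alpha=\rho_\alpha^i\,\partial/\partial x^i$. (Repeated indices are summed.) Let $S_0\in C^\infty(X;\mathbb R)$ be $\mathfrak g$-invariant: $\rho(a)S_0=0$ for all $a\in\mathfrak g$. Superfunctions are the elements of $C^\infty(X\times\mathbb R^r;\mathbb C)\otimes\Lambda[c^\alpha,x_i^*]$. Here $(x^i,c_\alpha^*)$ are the even coordinates, with $(c^*_\alpha)\in\mathbb R^r$, and the ghosts $c^\alpha$ ($1\le\alpha\le r$) and the $x_i^*$ ($1\le i\le N$) are the odd coordinates, which anticommute with one another. Derivatives by odd coordinates act from the left, $|\cdot|$ is the parity, and $\frac{\overleftarrow\partial F}{\partial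 y}=(-1)^{|y|(|F|+1)}\frac{\partial F}{\partial y}$, extended linearly in $F$. Define the BV Laplacian of $\Omega_0$ and the Schouten–Nijenhuis bracket by $$\Delta=\frac{\partial}{\partial x^i}\frac{\partial}{\partial x_i^*}-\frac{\partial}{\partial c^\alpha}\frac{\partial}{\partial c_\alpha^*},$$ $$\{F,G\}=\frac{\overleftarrow\partial F}{\partial x^i}\frac{\partial G}{\partial x_i^*}-\frac{\overleftarrow\partial F}{\partial x_i^*}\frac{\partial G}{\partial x^i}+\frac{\overleftarrow\partial F}{\partial c^\alpha}\frac{\partial G}{\partial c_\alpha^*}-\frac{\overleftarrow\partial F}{\partial c_\alpha^*}\frac{\partial G}{\partial c^\alpha}.$$ Let $$S=S_0-\tfrac12\,c^\alpha c^\beta C_{\alpha\beta}^\gamma c_\gamma^*+\rho_\alpha^i c^\alpha x_i^*$$ be the BV extension of $S_0$, let $\hbar$ be a nonzero real number, and define $e^{iS/\hbar}$ by the exponential series. Assume that the action preserves the Lebesgue measure, i.e. the Lie derivative $L_{\rho(a)}\Omega_0$ vanishes on $X$ for every $a\in\mathfrak g$, and that $\mathfrak g$ is unimodular, i.e. $\operatorname{tr}(\operatorname{ad}_a)=0$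 for every $a\in\mathfrak g$. Then $S$ and $e^{iS/\hbar}$ are smooth superfunctions, and 1. $\Delta S=0$; 2. $S$ satisfies the quantum master equation $\{S,S\}-i\hbar\,\Delta S=0$; 3. $e^{iS/\hbar}$ is $\Delta$-closed: $\Delta\big(e^{iS/\hbar}\big)=0$. -/

import Mathlib

open scoped ContDiff

noncomputable section

namespace BV

/-! ### The complex Grassmann algebra on finitely many odd generators -/

/-- The complex Grassmann algebra on odd generators indexed by `ι`. -/
def Grassmann (ι : Type) : Type := ExteriorAlgebra ℂ (ι → ℂ)

namespace Grassmann

variable {ι : Type}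

instance : Ring (Grassmann ι) := inferInstanceAs (Ring (ExteriorAlgebra ℂ (ι → ℂ)))

instance : Algebra ℂ (Grassmann ι) := inferInstanceAs (Algebra ℂ (ExteriorAlgebra ℂ (ι → ℂ)))

/-- The odd generator with index `j`. -/
def gen [DecidableEq ι] (j : ι) : Grassmann ι :=
  ExteriorAlgebra.ι ℂ (Pi.single j (1 : ℂ) : ι → ℂ)

/-- The left derivative `∂/∂θ_j`: the linear map that kills `1` and satisfies
`∂(θ_k a) = δ_{jk} a - θ_k ∂a`. -/
def leftDeriv (j : ι) : Grassmann ι →ₗ[ℂ] Grassmann ι :=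
  CliffordAlgebra.contractLeft (Q := (0 : QuadraticForm ℂ (ι → ℂ))) (LinearMap.proj j)

/-- The parity automorphism `a ↦ (-1)^{|a|} a`. -/
def parity : Grassmann ι →ₐ[ℂ] Grassmann ι :=
  CliffordAlgebra.involute (Q := (0 : QuadraticForm ℂ (ι → ℂ)))

instance [Finite ι] : Module.Finite ℂ (Grassmann ι) := by
  classical
  obtain ⟨n, ⟨f⟩⟩ := Finite.exists_equiv_fin ι
  exact Module.Finite.of_basis
    (((Pi.basisFun ℂ ι).reindex f).ExteriorAlgebra :
      Module.Basis (Finset (Fin n)) ℂ (ExteriorAlgebra ℂ (ι → ℂ)))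

/-- The left regular representation, in coordinates with respect to some basis. It serves only to
put a norm on the finite-dimensional algebra `Grassmann ι`. -/
def regularRep (ι : Type) [Finite ι] :
    Grassmann ι →ₐ[ℂ]
      ((Fin (Module.finrank ℂ (Grassmann ι)) → ℂ) →L[ℂ]
        (Fin (Module.finrank ℂ (Grassmann ι)) → ℂ)) :=
  (Module.End.toContinuousLinearMap (Fin (Module.finrank ℂ (Grassmann ι)) → ℂ) :
      Module.End ℂ (Fin (Module.finrank ℂ (Grassmann ι)) → ℂ) ≃ₐ[ℂ] _).toAlgHom.comp
    (((Module.finBasis ℂ (Grassmann ι)).equivFun.conjAlgEquiv ℂ).toAlgHom.comp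
      (Algebra.lmul ℂ (Grassmann ι)))

theorem regularRep_injective (ι : Type) [Finite ι] : Function.Injective (regularRep ι) := by
  intro a b h
  have h1 : Algebra.lmul ℂ (Grassmann ι) a = Algebra.lmul ℂ (Grassmann ι) b :=
    ((Module.finBasis ℂ (Grassmann ι)).equivFun.conjAlgEquiv ℂ).injective
      ((Module.End.toContinuousLinearMap
        (Fin (Module.finrank ℂ (Grassmann ι)) → ℂ)).injective h)
  simpa using congrArg (fun T : Module.End ℂ (Grassmann ι) => T 1) h1

/- A submultiplicative norm on the Grassmann algebra. All norms on a finite-dimensional space are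
equivalent, so smoothness, derivatives and the exponential series do not depend on this choice. -/
instance [Finite ι] : NormedRing (Grassmann ι) :=
  NormedRing.induced (Grassmann ι) _ (regularRep ι) (regularRep_injective ι)

instance [Finite ι] : NormedAlgebra ℂ (Grassmann ι) :=
  NormedAlgebra.induced ℂ (Grassmann ι) _ (regularRep ι)

end Grassmann

/-! ### Superfunctions on the shifted cotangent bundle

The even coordinates are `(x, c*) ∈ ℝ^N × ℝ^r`; the odd ones are `x*_i` (index `Sum.inl i`) and the
ghosts `c^α` (index `Sum.inr α`). -/

/-- The space of values of the even coordinates `(x, c*)`. -/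
abbrev Even (N r : ℕ) : Type := EuclideanSpace ℝ (Fin N) × (Fin r → ℝ)

/-- Grassmann-algebra-valued functions of the even coordinates. -/
abbrev SuperFun (N r : ℕ) : Type := Even N r → Grassmann (Fin N ⊕ Fin r)

variable {N r : ℕ}

/-- The region of the even coordinates lying over `U`. -/
def region (U : Set (EuclideanSpace ℝ (Fin N))) (r : ℕ) : Set (Even N r) := U ×ˢ Set.univ

/-- `F` is a smooth superfunction over `U`. -/
def IsSmoothSuperFun (U : Set (EuclideanSpace ℝ (Fin N))) (F : SuperFun N r) : Prop :=
  ContDiffOn ℝ ∞ F (region U r)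

/-- A complex function of `x`, as a superfunction. -/
def ofFun (f : EuclideanSpace ℝ (Fin N) → ℂ) : SuperFun N r :=
  fun p => algebraMap ℂ _ (f p.1)

/-- The odd coordinate `x*_i`. -/
def xStar (i : Fin N) : SuperFun N r := fun _ => Grassmann.gen (Sum.inl i)

/-- The ghost `c^α`, an odd coordinate. -/
def ghost (α : Fin r) : SuperFun N r := fun _ => Grassmann.gen (Sum.inr α)

/-- The even coordinate `c*_α`. -/
def ghostStar (α : Fin r) : SuperFun N r := fun p => algebraMap ℂ _ ((p.2 α : ℝ) : ℂ)

/-- `∂F/∂x^i`. -/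
def dX (i : Fin N) (F : SuperFun N r) : SuperFun N r :=
  fun p => fderiv ℝ F p (EuclideanSpace.single i (1 : ℝ), 0)

/-- `∂F/∂c*_α`. -/
def dGhostStar (α : Fin r) (F : SuperFun N r) : SuperFun N r :=
  fun p => fderiv ℝ F p (0, Pi.single α (1 : ℝ))

/-- `∂F/∂x*_i` (acting from the left). -/
def dXStar (i : Fin N) (F : SuperFun N r) : SuperFun N r :=
  fun p => Grassmann.leftDeriv (Sum.inl i) (F p)

/-- `∂F/∂c^α` (acting from the left). -/
def dGhost (α : Fin r) (F : SuperFun N r) : SuperFun N r :=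
  fun p => Grassmann.leftDeriv (Sum.inr α) (F p)

/-- The derivative of `F` by `x*_i` acting from the right: `(-1)^{|F|+1} ∂F/∂x*_i` when `F` is
homogeneous. -/
def dXStarR (i : Fin N) (F : SuperFun N r) : SuperFun N r :=
  fun p => -Grassmann.leftDeriv (Sum.inl i) (Grassmann.parity (F p))

/-- The derivative of `F` by `c^α` acting from the right: `(-1)^{|F|+1} ∂F/∂c^α` when `F` is
homogeneous. -/
def dGhostR (α : Fin r) (F : SuperFun N r) : SuperFun N r :=
  fun p => -Grassmann.leftDeriv (Sum.inr α) (Grassmann.parity (F p))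

/-- The BV Laplacian of the Lebesgue measure, `∂/∂x^i ∂/∂x*_i - ∂/∂c^α ∂/∂c*_α`. -/
def laplacian (F : SuperFun N r) : SuperFun N r :=
  (∑ i, dX i (dXStar i F)) - ∑ α, dGhost α (dGhostStar α F)

/-- The Schouten–Nijenhuis bracket (antibracket). -/
def bracket (F G : SuperFun N r) : SuperFun N r :=
  (∑ i, (dX i F * dXStar i G - dXStarR i F * dX i G)) +
    ∑ α, (dGhostR α F * dGhostStar α G - dGhostStar α F * dGhost α G)

/-- `e^{iF/ħ}`, by the exponential series in the Grassmann algebra. -/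
def expI (hbar : ℝ) (F : SuperFun N r) : SuperFun N r :=
  fun p => NormedSpace.exp ((Complex.I / (hbar : ℂ)) • F p)

/-- `F` is `Δ`-closed over `U`. -/
def IsLaplacianClosed (U : Set (EuclideanSpace ℝ (Fin N))) (F : SuperFun N r) : Prop :=
  ∀ p ∈ region U r, laplacian F p = 0

/-- The quantum master equation `{F, F} - iħ ΔF = 0` over `U`. -/
def QuantumMasterEquation (U : Set (EuclideanSpace ℝ (Fin N))) (hbar : ℝ) (F : SuperFun N r) :
    Prop :=
  ∀ p ∈ region U r, bracket F F p - (Complex.I * (hbar : ℂ)) • laplacian F p = 0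

/-! ### Lie algebra actions and the BV extension of an invariant action -/

section Action

variable {g : Type*} [LieRing g] [LieAlgebra ℝ g]

/-- `ρ` is a smooth action of the Lie algebra `g` on `U`, i.e. a Lie algebra homomorphism from `g`
to the vector fields on `U`. -/
structure IsLieAction (U : Set (EuclideanSpace ℝ (Fin N)))
    (ρ : g →ₗ[ℝ] (EuclideanSpace ℝ (Fin N) → EuclideanSpace ℝ (Fin N))) : Prop where
  smooth : ∀ a, ContDiffOn ℝ ∞ (ρ a) U
  map_lie : ∀ a b, ∀ x ∈ U, ρ ⁅a, b⁆ x = VectorField.lieBracket ℝ (ρ a) (ρ b) x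

/-- The structure constants `C_{αβ}^γ`, with `[e_α, e_β] = C_{αβ}^γ e_γ`. -/
def structureConst (e : Module.Basis (Fin r) ℝ g) (α β γ : Fin r) : ℝ := e.repr ⁅e α, e β⁆ γ

/-- `S = S_0 - (1/2) c^α c^β C_{αβ}^γ c*_γ + ρ_α^i c^α x*_i`. -/
def bvAction (e : Module.Basis (Fin r) ℝ g)
    (ρ : g →ₗ[ℝ] (EuclideanSpace ℝ (Fin N) → EuclideanSpace ℝ (Fin N)))
    (S₀ : EuclideanSpace ℝ (Fin N) → ℝ) : SuperFun N r :=
  ofFun (fun x => (S₀ x : ℂ)) +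
    (∑ α, ∑ β, ∑ γ,
      (-(1 / 2 : ℂ) * (structureConst e α β γ : ℂ)) • (ghost α * ghost β * ghostStar γ)) +
    ∑ α, ∑ i, ofFun (fun x => ((ρ (e α) x i : ℝ) : ℂ)) * ghost α * xStar i

/-- The Lie algebra `g` is unimodular: `tr (ad a) = 0` for every `a`. -/
def IsUnimodular (g : Type*) [LieRing g] [LieAlgebra ℝ g] : Prop :=
  ∀ a : g, LinearMap.trace ℝ g (LieAlgebra.ad ℝ g a) = 0

end Action

/-- The constant top-degree form `dx^1 ∧ ⋯ ∧ dx^N`. -/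
def lebesgueForm (N : ℕ) :
    EuclideanSpace ℝ (Fin N) → (EuclideanSpace ℝ (Fin N)) [⋀^Fin N]→ₗ[ℝ] ℝ :=
  fun _ => (EuclideanSpace.basisFun (Fin N) ℝ).toBasis.det

/-- The Lie derivative of a `k`-form `η` along a vector field `V`:
`(L_V η)(v_1, …, v_k) = V(η(v_1, …, v_k)) + ∑_j η(v_1, …, DV(v_j), …, v_k)` for constant `v_j`. -/
def lieDerivForm {k : ℕ} (V : EuclideanSpace ℝ (Fin N) → EuclideanSpace ℝ (Fin N))
    (η : EuclideanSpace ℝ (Fin N) → (EuclideanSpace ℝ (Fin N)) [⋀^Fin k]→ₗ[ℝ] ℝ)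
    (x : EuclideanSpace ℝ (Fin N)) (v : Fin k → EuclideanSpace ℝ (Fin N)) : ℝ :=
  fderiv ℝ (fun y => η y v) x (V x) +
    ∑ j, η x (Function.update v j (fderiv ℝ V x (v j)))

/-- The vector field `V` preserves the volume form `dx^1 ∧ ⋯ ∧ dx^N` on `U`. -/
def PreservesLebesgue (U : Set (EuclideanSpace ℝ (Fin N)))
    (V : EuclideanSpace ℝ (Fin N) → EuclideanSpace ℝ (Fin N)) : Prop :=
  ∀ x ∈ U, ∀ v, lieDerivForm V (lebesgueForm N) x v = 0

end BV

end

/-!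
`Δ` is a second-order differential operator whose symbol is the antibracket: for an even
superfunction `F`, `Δ(e^F) = (ΔF + ½{F, F}) e^F` (`laplacian_exp`). Since `Δ` is linear and the
bracket is quadratic, the quantum master equation and the closedness of `e^{iS/ħ}` both reduce to
`ΔS = 0` and the classical master equation `{S, S} = 0`.

* `ΔS = 0` (`laplacian_bvAction`). One computes `ΔS = -∑ α, (div ρ_α + tr ad e_α) c^α`. The
  divergence of a field is the coefficient of its Lie derivative of `dx^1 ∧ ⋯ ∧ dx^N`
  (`PreservesLebesgue.div_eq_zero`), and `tr ad e_α = C_{αγ}^γ` (`trace_ad_basis`).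
* `{S, S} = 0` (`bracket_bvAction`). As `S` is even, `½{S, S}` equals
  `∂S/∂x^i ∂S/∂x*_i - ∂S/∂c*_α ∂S/∂c^α` (`bracket_self`). In the first sum the term linear in the
  ghosts vanishes by invariance of `S₀`, and the rest is `(ρ_β^i ∂_i ρ_α^j) c^α c^β x*_j`
  (`sum_dX_mul_dXStar_bvAction`). In the second sum the term cubic in the ghosts vanishes by the
  Jacobi identity (`sum_jacobi_smul_ghost`), and the rest equals the same expression because `ρ` is
  a homomorphism of Lie algebras (`sum_dGhostStar_mul_dGhost_bvAction`).

Even elements are handled through `Grassmann.evenCenter`, the subalgebra of central elements fixed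
by the parity automorphism. It contains every value of `S` and of its derivatives by the even
coordinates; on it the left derivatives satisfy the Leibniz rule without signs, so the usual chain
rule holds for the exponential.
-/

namespace BV

/-! ### Even central elements of the Grassmann algebra -/

namespace Grassmann

variable {ι : Type}

theorem parity_gen [DecidableEq ι] (j : ι) : parity (gen j : Grassmann ι) = -gen j :=
  CliffordAlgebra.involute_ι _

theorem leftDeriv_gen_mul [DecidableEq ι] (j k : ι) (a : Grassmann ι) :
    leftDeriv j (gen k * a) = (if k = j then a else 0) - gen k * leftDeriv j a := by
  have h : leftDeriv j (gen k * a) =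
      (Pi.single k (1 : ℂ) : ι → ℂ) j • a - gen k * leftDeriv j a :=
    CliffordAlgebra.contractLeft_ι_mul _ _ _
  rw [h, Pi.single_apply, ite_smul, one_smul, zero_smul]
  simp only [eq_comm]

theorem leftDeriv_algebraMap (j : ι) (z : ℂ) :
    leftDeriv j (algebraMap ℂ (Grassmann ι) z) = 0 :=
  CliffordAlgebra.contractLeft_algebraMap (Q := (0 : QuadraticForm ℂ (ι → ℂ))) _ _

theorem leftDeriv_one (j : ι) : leftDeriv j (1 : Grassmann ι) = 0 :=
  CliffordAlgebra.contractLeft_one (Q := (0 : QuadraticForm ℂ (ι → ℂ))) _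

theorem leftDeriv_gen [DecidableEq ι] (j k : ι) :
    leftDeriv j (gen k : Grassmann ι) = if k = j then 1 else 0 := by
  simpa [leftDeriv_one] using leftDeriv_gen_mul j k (1 : Grassmann ι)

/-- The left derivative is an odd derivation. -/
theorem leftDeriv_mul (j : ι) (a b : Grassmann ι) :
    leftDeriv j (a * b) = leftDeriv j a * b + parity a * leftDeriv j b := by
  induction a using CliffordAlgebra.left_induction with
  | algebraMap z =>
    have h1 : leftDeriv j (algebraMap ℂ (Grassmann ι) z) = 0 := leftDeriv_algebraMap j z
    have h2 : parity (algebraMap ℂ (Grassmann ι) z) = algebraMap ℂ _ z := parity.commutes z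
    have h3 : leftDeriv j (algebraMap ℂ (Grassmann ι) z * b)
        = leftDeriv j (algebraMap ℂ (Grassmann ι) z) * b
          + parity (algebraMap ℂ (Grassmann ι) z) * leftDeriv j b := by
      rw [h1, h2, zero_mul, zero_add, ← Algebra.smul_def, map_smul, Algebra.smul_def]
    exact h3
  | add x y hx hy =>
    have h : ∀ x y : Grassmann ι,
        leftDeriv j (x * b) = leftDeriv j x * b + parity x * leftDeriv j b →
        leftDeriv j (y * b) = leftDeriv j y * b + parity y * leftDeriv j b →
        leftDeriv j ((x + y) * b)
          = leftDeriv j (x + y) * b + parity (x + y) * leftDeriv j b := by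
      intro x y hx hy
      rw [add_mul, map_add, map_add, map_add, hx, hy, add_mul, add_mul]
      abel
    exact h x y hx hy
  | ι_mul x m hx =>
    have h : ∀ (v x : Grassmann ι) (z : ℂ),
        (∀ y, leftDeriv j (v * y) = z • y - v * leftDeriv j y) → parity v = -v →
        leftDeriv j (x * b) = leftDeriv j x * b + parity x * leftDeriv j b →
        leftDeriv j (v * x * b)
          = leftDeriv j (v * x) * b + parity (v * x) * leftDeriv j b := by
      intro v x z hv hp hx
      rw [mul_assoc, hv, hx, hv, map_mul, hp, sub_mul, mul_add, smul_mul_assoc]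
      simp only [neg_mul, mul_assoc]
      abel
    exact h _ x (m j) (fun y => CliffordAlgebra.contractLeft_ι_mul _ _ _)
      (CliffordAlgebra.involute_ι m) hx

theorem leftDeriv_real_smul (j : ι) (t : ℝ) (a : Grassmann ι) :
    leftDeriv j (t • a) = t • leftDeriv j a := by
  rw [← Complex.coe_smul, map_smul, Complex.coe_smul]

theorem gen_mul_gen [DecidableEq ι] (j k : ι) :
    (gen j * gen k : Grassmann ι) = -(gen k * gen j) :=
  eq_neg_of_add_eq_zero_left
    (ExteriorAlgebra.ι_add_mul_swap (R := ℂ) (Pi.single j (1 : ℂ) : ι → ℂ) (Pi.single k 1))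

theorem commute_ι_gen_mul_gen [DecidableEq ι] (j k : ι) (m : ι → ℂ) :
    (show Grassmann ι from ExteriorAlgebra.ι ℂ m) * (gen j * gen k) =
      (gen j * gen k) * (show Grassmann ι from ExteriorAlgebra.ι ℂ m) := by
  have h : ∀ l : ι, (show Grassmann ι from ExteriorAlgebra.ι ℂ m) * gen l =
      -(gen l * (show Grassmann ι from ExteriorAlgebra.ι ℂ m)) := fun l =>
    eq_neg_of_add_eq_zero_left
      (ExteriorAlgebra.ι_add_mul_swap (R := ℂ) m (Pi.single l (1 : ℂ) : ι → ℂ))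
  rw [← mul_assoc, h, neg_mul, mul_assoc, h, mul_neg, neg_neg, mul_assoc]

/-- The subalgebra of the central elements that are fixed by the parity automorphism. -/
noncomputable def evenCenter (ι : Type) : Subalgebra ℂ (Grassmann ι) :=
  Subalgebra.center ℂ (Grassmann ι) ⊓ AlgHom.equalizer parity (AlgHom.id ℂ _)

theorem mem_evenCenter {a : Grassmann ι} :
    a ∈ evenCenter ι ↔ (∀ b, b * a = a * b) ∧ parity a = a := by
  simp [evenCenter, Algebra.mem_inf, Subalgebra.mem_center_iff, AlgHom.mem_equalizer]

theorem gen_mul_gen_mem_evenCenter [DecidableEq ι] (j k : ι) :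
    (gen j * gen k : Grassmann ι) ∈ evenCenter ι := by
  refine mem_evenCenter.2 ⟨fun b => ?_, by rw [map_mul, parity_gen, parity_gen, neg_mul_neg]⟩
  induction b using CliffordAlgebra.left_induction with
  | algebraMap z =>
    have h : algebraMap ℂ (Grassmann ι) z * (gen j * gen k) = gen j * gen k * algebraMap ℂ _ z :=
      Algebra.commutes z _
    exact h
  | add x y hx hy =>
    exact (add_mul (R := Grassmann ι) x y _).trans
      ((congrArg₂ (· + ·) hx hy).trans (mul_add (R := Grassmann ι) _ x y).symm)
  | ι_mul x m hx =>
    have h : ∀ v x w : Grassmann ι, v * w = w * v → x * w = w * x →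
        v * x * w = w * (v * x) := by
      intro v x w hv hx
      rw [mul_assoc, hx, ← mul_assoc, hv, mul_assoc]
    exact h _ x _ (commute_ι_gen_mul_gen j k m) hx

/-- On even central elements the left derivative satisfies the Leibniz rule without signs. -/
theorem leftDeriv_pow (j : ι) {a : Grassmann ι} (ha : a ∈ evenCenter ι) (n : ℕ) :
    leftDeriv j (a ^ (n + 1)) = ((n : ℂ) + 1) • (leftDeriv j a * a ^ n) := by
  induction n with
  | zero => simp
  | succ n ih =>
    rw [pow_succ', leftDeriv_mul, ih, (mem_evenCenter.1 ha).2, mul_smul_comm, ← mul_assoc,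
      ← (mem_evenCenter.1 ha).1, mul_assoc, ← pow_succ']
    push_cast
    module

section Finite

variable [Finite ι]

instance : CompleteSpace (Grassmann ι) := FiniteDimensional.complete ℂ _

/-- The left derivative as a real continuous linear map. -/
noncomputable def leftDerivL (j : ι) : Grassmann ι →L[ℝ] Grassmann ι :=
  LinearMap.toContinuousLinearMap ((leftDeriv j).restrictScalars ℝ)

/-- The parity automorphism as a real continuous linear map. -/
noncomputable def parityL : Grassmann ι →L[ℝ] Grassmann ι :=
  LinearMap.toContinuousLinearMap ((parity (ι := ι)).toLinearMap.restrictScalars ℝ)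

theorem leftDerivL_apply (j : ι) (a : Grassmann ι) : leftDerivL j a = leftDeriv j a := rfl

/-- On even central elements the left derivative obeys the chain rule for the exponential. -/
theorem leftDeriv_exp (j : ι) {a : Grassmann ι} (ha : a ∈ evenCenter ι) :
    leftDeriv j (NormedSpace.exp a) = leftDeriv j a * NormedSpace.exp a := by
  have h := NormedSpace.exp_series_hasSum_exp' (𝕂 := ℂ) a
  have h1 := h.mapL (leftDerivL j)
  rw [← hasSum_nat_add_iff' 1] at h1
  have h2 := h.mul_left (leftDeriv j a)
  -- Apart from the constant term, the differentiated series is the series of `∂a * exp a`, shifted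
  -- by one.
  have h3 := h1.unique (h2.congr_fun ?_)
  · simpa [leftDerivL_apply, leftDeriv_one] using h3
  · intro n
    rw [leftDerivL_apply, map_smul, leftDeriv_pow j ha, smul_smul, mul_smul_comm]
    congr 1
    rw [Nat.factorial_succ]
    have : ((n : ℂ) + 1) ≠ 0 := by exact_mod_cast n.succ_ne_zero
    push_cast
    field_simp

/-- The chain rule for the exponential of a function with even central values, so that all values
commute. -/
theorem hasFDerivAt_exp_comp {E : Type*} [NormedAddCommGroup E] [NormedSpace ℝ E]
    {F : E → Grassmann ι} {F' : E →L[ℝ] Grassmann ι} {p : E}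
    (hF : ∀ q, F q ∈ evenCenter ι) (h : HasFDerivAt F F' p) :
    HasFDerivAt (fun q => NormedSpace.exp (F q)) (NormedSpace.exp (F p) • F') p := by
  let _ : NormedAlgebra ℚ (Grassmann ι) := NormedAlgebra.restrictScalars ℚ ℝ _
  -- By commutativity `exp (F q) = exp (F p) * exp (F q - F p)`, so only the derivative of `exp` at
  -- `0` matters.
  have h0 : HasFDerivAt (NormedSpace.exp : Grassmann ι → Grassmann ι)
      (1 : Grassmann ι →L[ℝ] Grassmann ι) (F p - F p) := by
    rw [sub_self]; exact hasFDerivAt_exp_zero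
  have h1 := (h0.comp p (h.sub_const (F p))).const_mul (NormedSpace.exp (F p))
  refine h1.congr_of_eventuallyEq (Filter.Eventually.of_forall fun q => ?_)
  show NormedSpace.exp (F q) = NormedSpace.exp (F p) * NormedSpace.exp (F q - F p)
  rw [← NormedSpace.exp_add_of_commute, add_sub_cancel]
  exact (mem_evenCenter.1 (sub_mem (hF q) (hF p))).1 _

/-- Derivatives of functions with even central values are even and central. -/
theorem fderiv_mem_evenCenter {E : Type*} [NormedAddCommGroup E] [NormedSpace ℝ E]
    {F : E → Grassmann ι} {p : E} (hF : ∀ q, F q ∈ evenCenter ι) (h : DifferentiableAt ℝ F p)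
    (v : E) : fderiv ℝ F p v ∈ evenCenter ι := by
  refine mem_evenCenter.2 ⟨fun b => ?_, ?_⟩
  · have h1 := h.hasFDerivAt.const_mul b
    have h2 := h.hasFDerivAt.mul_const' b
    rw [show (fun q => b * F q) = fun q => F q * b from
      funext fun q => (mem_evenCenter.1 (hF q)).1 b] at h1
    exact DFunLike.congr_fun (h1.unique h2) v
  · have h1 := (parityL (ι := ι)).hasFDerivAt.comp p h.hasFDerivAt
    rw [show (parityL ∘ F) = F from funext fun q => (mem_evenCenter.1 (hF q)).2] at h1
    exact DFunLike.congr_fun (h1.unique h.hasFDerivAt) v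

end Finite

end Grassmann

/-! ### The BV Laplacian of an exponential -/

variable {N r : ℕ}

open Grassmann

/-- For even superfunctions the four terms of `{F, F}` agree in pairs. -/
theorem bracket_self {F : SuperFun N r} (hF : ∀ q, F q ∈ evenCenter (Fin N ⊕ Fin r))
    {p : Even N r} (hd : DifferentiableAt ℝ F p) :
    bracket F F p = (2 : ℂ) •
      ((∑ i, dX i F p * dXStar i F p) - ∑ α, dGhostStar α F p * dGhost α F p) := by
  have hA : ∀ i, dX i F p ∈ evenCenter (Fin N ⊕ Fin r) := fun i => fderiv_mem_evenCenter hF hd _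
  have hK : ∀ α, dGhostStar α F p ∈ evenCenter (Fin N ⊕ Fin r) :=
    fun α => fderiv_mem_evenCenter hF hd _
  have hxR : ∀ i, dXStarR i F p = -dXStar i F p := fun i => by
    rw [dXStarR, (mem_evenCenter.1 (hF p)).2]; rfl
  have hcR : ∀ α, dGhostR α F p = -dGhost α F p := fun α => by
    rw [dGhostR, (mem_evenCenter.1 (hF p)).2]; rfl
  simp only [bracket, Pi.add_apply, Pi.sub_apply, Finset.sum_apply, Pi.mul_apply, hxR, hcR, neg_mul,
    sub_neg_eq_add, Finset.sum_add_distrib]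
  have h4 : ∀ i, dXStar i F p * dX i F p = dX i F p * dXStar i F p := fun i =>
    (mem_evenCenter.1 (hA i)).1 _
  have h5 : ∀ α, dGhost α F p * dGhostStar α F p = dGhostStar α F p * dGhost α F p := fun α =>
    (mem_evenCenter.1 (hK α)).1 _
  simp only [h4, h5, Finset.sum_sub_distrib, Finset.sum_neg_distrib]
  module

theorem laplacian_const_smul (z : ℂ) (F : SuperFun N r) (p : Even N r) :
    laplacian (z • F) p = z • laplacian F p := by
  have h (v : Even N r) (G : SuperFun N r) :
      fderiv ℝ (z • G) p v = z • fderiv ℝ G p v := by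
    rw [fderiv_const_smul_field]; rfl
  have hs (i : Fin N) : dXStar i (z • F) = z • dXStar i F :=
    funext fun q => map_smul (leftDeriv (Sum.inl i)) z (F q)
  simp [laplacian, dX, dGhost, dGhostStar, h, hs, smul_sub, Finset.smul_sum]

theorem bracket_const_smul (z : ℂ) (F : SuperFun N r) (p : Even N r) :
    bracket (z • F) (z • F) p = z ^ 2 • bracket F F p := by
  have h (v : Even N r) (G : SuperFun N r) :
      fderiv ℝ (z • G) p v = z • fderiv ℝ G p v := by
    rw [fderiv_const_smul_field]; rfl
  simp [bracket, dX, dXStar, dXStarR, dGhost, dGhostR, dGhostStar, h, smul_sub, smul_add,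
    Finset.smul_sum, smul_smul, sq]

/-- `Δ(e^F) = (ΔF + ½{F, F}) e^F` for a superfunction `F` with even values: `Δ` is a differential
operator of second order whose symbol is the bracket. -/
theorem laplacian_exp {F : SuperFun N r} (hF : ∀ q, F q ∈ evenCenter (Fin N ⊕ Fin r))
    {p : Even N r} (hd : DifferentiableAt ℝ F p) :
    laplacian (fun q => NormedSpace.exp (F q)) p =
      (laplacian F p + (1 / 2 : ℂ) • bracket F F p) * NormedSpace.exp (F p) := by
  have hA : ∀ i, dX i F p ∈ evenCenter (Fin N ⊕ Fin r) := fun i => fderiv_mem_evenCenter hF hd _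
  have hK : ∀ α, dGhostStar α F p ∈ evenCenter (Fin N ⊕ Fin r) :=
    fun α => fderiv_mem_evenCenter hF hd _
  have hexp := hasFDerivAt_exp_comp hF hd.hasFDerivAt
  have hx : ∀ i, dX i (dXStar i fun q => NormedSpace.exp (F q)) p =
      dX i (dXStar i F) p * NormedSpace.exp (F p) +
        dX i F p * dXStar i F p * NormedSpace.exp (F p) := by
    intro i
    have h1 : (dXStar i fun q => NormedSpace.exp (F q)) =
        fun q => dXStar i F q * NormedSpace.exp (F q) :=
      funext fun q => leftDeriv_exp _ (hF q)
    have h2 : HasFDerivAt (dXStar i F) (fderiv ℝ (dXStar i F) p) p :=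
      ((leftDerivL (Sum.inl i)).hasFDerivAt.comp p hd.hasFDerivAt).differentiableAt.hasFDerivAt
    rw [h1, dX, show (fun q => dXStar i F q * NormedSpace.exp (F q)) =
      dXStar i F * fun q => NormedSpace.exp (F q) from rfl, (h2.mul' hexp).fderiv]
    have h3 : Commute (dX i F p) (NormedSpace.exp (F p)) :=
      ((mem_evenCenter.1 (hA i)).1 _).symm
    simp only [add_apply, smul_apply, smul_eq_mul,
      MulOpposite.smul_eq_mul_unop, MulOpposite.unop_op]
    change dXStar i F p * (NormedSpace.exp (F p) * dX i F p) + dX i (dXStar i F) p * _ = _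
    rw [← h3.eq, ← mul_assoc, (mem_evenCenter.1 (hA i)).1, add_comm]
  have hc : ∀ α, dGhost α (dGhostStar α fun q => NormedSpace.exp (F q)) p =
      dGhost α (dGhostStar α F) p * NormedSpace.exp (F p) +
        dGhostStar α F p * dGhost α F p * NormedSpace.exp (F p) := by
    intro α
    have h1 : dGhostStar α (fun q => NormedSpace.exp (F q)) p =
        dGhostStar α F p * NormedSpace.exp (F p) := by
      rw [dGhostStar, hexp.fderiv]
      exact (mem_evenCenter.1 (hK α)).1 _
    rw [dGhost, h1, leftDeriv_mul, (mem_evenCenter.1 (hK α)).2, leftDeriv_exp _ (hF p), mul_assoc]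
    rfl
  simp only [laplacian, bracket_self hF hd, Pi.sub_apply, Finset.sum_apply, hx, hc,
    Finset.sum_add_distrib, ← Finset.sum_mul, ← add_mul, ← sub_mul]
  congr 1
  module

/-- If `F` is even, `ΔF = 0` and `{F, F} = 0`, then `e^{iF/ħ}` is `Δ`-closed. -/
theorem laplacian_expI_eq_zero {F : SuperFun N r}
    (hF : ∀ q, F q ∈ evenCenter (Fin N ⊕ Fin r)) {p : Even N r} (hd : DifferentiableAt ℝ F p)
    (hΔ : laplacian F p = 0) (hb : bracket F F p = 0) (hbar : ℝ) :
    laplacian (expI hbar F) p = 0 := by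
  have h := laplacian_exp (F := (Complex.I / (hbar : ℂ)) • F)
    (fun q => Subalgebra.smul_mem _ (hF q) _) (hd.const_smul (Complex.I / (hbar : ℂ)))
  rw [laplacian_const_smul, bracket_const_smul, hΔ, hb, smul_zero, smul_zero, smul_zero, add_zero,
    zero_mul] at h
  exact h

theorem isSmoothSuperFun_expI {U : Set (EuclideanSpace ℝ (Fin N))} {F : SuperFun N r}
    (hF : IsSmoothSuperFun U F) (hbar : ℝ) :
    IsSmoothSuperFun U (expI hbar F) := by
  have h : ContDiff ℝ ∞ (NormedSpace.exp : Grassmann (Fin N ⊕ Fin r) → _) :=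
    contDiff_iff_contDiffAt.2 fun a => (NormedSpace.exp_analytic (𝕂 := ℝ) a).contDiffAt
  exact h.comp_contDiffOn (hF.const_smul _)

/-! ### The BV action in coordinates -/

section Action

variable {g : Type*} [LieRing g] [LieAlgebra ℝ g]
  (e : Module.Basis (Fin r) ℝ g)
  (ρ : g →ₗ[ℝ] (EuclideanSpace ℝ (Fin N) → EuclideanSpace ℝ (Fin N)))
  (S₀ : EuclideanSpace ℝ (Fin N) → ℝ)

/-- The BV action as a combination of constant elements with real coefficient functions. -/
theorem bvAction_apply (p : Even N r) :
    bvAction e ρ S₀ p = S₀ p.1 • 1 +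
      (∑ α, ∑ β, ∑ γ, (-(1 / 2) * structureConst e α β γ * p.2 γ) •
        (gen (Sum.inr α) * gen (Sum.inr β))) +
      ∑ α, ∑ i, ρ (e α) p.1 i • (gen (Sum.inr α) * gen (Sum.inl i)) := by
  simp only [bvAction, Pi.add_apply, Finset.sum_apply, Pi.smul_apply, Pi.mul_apply, ofFun, ghost,
    xStar, ghostStar, ← Complex.coe_smul]
  congr 1
  · congr 1
    · rw [Algebra.algebraMap_eq_smul_one]
    · refine Finset.sum_congr rfl fun α _ => Finset.sum_congr rfl fun β _ =>
        Finset.sum_congr rfl fun γ _ => ?_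
      rw [← Algebra.commutes, ← Algebra.smul_def, smul_smul]
      push_cast
      rfl
  · refine Finset.sum_congr rfl fun α _ => Finset.sum_congr rfl fun i _ => ?_
    rw [mul_assoc, ← Algebra.smul_def]

theorem bvAction_mem_evenCenter (p : Even N r) :
    bvAction e ρ S₀ p ∈ evenCenter (Fin N ⊕ Fin r) := by
  have h : ∀ (t : ℝ) {a : Grassmann (Fin N ⊕ Fin r)}, a ∈ evenCenter (Fin N ⊕ Fin r) →
      t • a ∈ evenCenter (Fin N ⊕ Fin r) := fun t a ha => by
    rw [← Complex.coe_smul]; exact Subalgebra.smul_mem _ ha _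
  rw [bvAction_apply]
  exact add_mem (add_mem (h _ (one_mem _)) (sum_mem fun α _ => sum_mem fun β _ => sum_mem fun γ _ =>
    h _ (gen_mul_gen_mem_evenCenter _ _))) (sum_mem fun α _ => sum_mem fun i _ =>
    h _ (gen_mul_gen_mem_evenCenter _ _))

variable {ρ S₀} {U : Set (EuclideanSpace ℝ (Fin N))}

theorem isSmoothSuperFun_bvAction (hρ : IsLieAction U ρ) (hS₀ : ContDiffOn ℝ ∞ S₀ U) :
    IsSmoothSuperFun U (bvAction e ρ S₀) := by
  have hfst : ContDiffOn ℝ ∞ (Prod.fst : Even N r → _) (region U r) := contDiff_fst.contDiffOn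
  have hmaps : Set.MapsTo (Prod.fst : Even N r → _) (region U r) U := fun p hp => hp.1
  rw [IsSmoothSuperFun, funext (bvAction_apply e ρ S₀)]
  have h1 : ∀ α β γ, ContDiffOn ℝ ∞
      (fun p : Even N r => -(1 / 2) * structureConst e α β γ * p.2 γ) (region U r) := by
    intro α β γ
    fun_prop
  have h2 : ∀ α i, ContDiffOn ℝ ∞ (fun p : Even N r => ρ (e α) p.1 i) (region U r) :=
    fun α i => (contDiffOn_euclidean.1 (hρ.smooth (e α)) i).comp hfst hmaps
  have h0 : ContDiffOn ℝ ∞ (fun p : Even N r => S₀ p.1) (region U r) := hS₀.comp hfst hmaps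
  have hs : ∀ {f : Even N r → ℝ} (a : Grassmann (Fin N ⊕ Fin r)),
      ContDiffOn ℝ ∞ f (region U r) → ContDiffOn ℝ ∞ (fun p => f p • a) (region U r) :=
    fun a hf => hf.smul contDiffOn_const
  refine ContDiffOn.add (ContDiffOn.add (hs _ h0) ?_) ?_
  · exact ContDiffOn.sum fun α _ => ContDiffOn.sum fun β _ => ContDiffOn.sum fun γ _ =>
      hs _ (h1 α β γ)
  · exact ContDiffOn.sum fun α _ => ContDiffOn.sum fun i _ => hs _ (h2 α i)

theorem hasFDerivAt_bvAction {p : Even N r} (hρ : ∀ a, DifferentiableAt ℝ (ρ a) p.1)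
    (hS₀ : DifferentiableAt ℝ S₀ p.1) :
    HasFDerivAt (bvAction e ρ S₀)
      (((fderiv ℝ S₀ p.1).comp (.fst ℝ _ _)).smulRight 1 +
        (∑ α, ∑ β, ∑ γ, ((-(1 / 2) * structureConst e α β γ) •
          ((ContinuousLinearMap.proj γ).comp (.snd ℝ _ _) : Even N r →L[ℝ] ℝ)).smulRight
          (gen (Sum.inr α) * gen (Sum.inr β))) +
        ∑ α, ∑ i, ((EuclideanSpace.proj i).comp
          ((fderiv ℝ (ρ (e α)) p.1).comp (.fst ℝ _ _)) : Even N r →L[ℝ] ℝ).smulRight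
          (gen (Sum.inr α) * gen (Sum.inl i))) p := by
  rw [funext (bvAction_apply e ρ S₀)]
  refine ((hS₀.hasFDerivAt.comp p hasFDerivAt_fst).smul_const _).add (HasFDerivAt.fun_sum fun α _ =>
    HasFDerivAt.fun_sum fun β _ => HasFDerivAt.fun_sum fun γ _ => HasFDerivAt.smul_const ?_ _)
    |>.add (HasFDerivAt.fun_sum fun α _ => HasFDerivAt.fun_sum fun i _ =>
      HasFDerivAt.smul_const ?_ _)
  · exact ((ContinuousLinearMap.proj γ).comp
      (.snd ℝ _ _) : Even N r →L[ℝ] ℝ).hasFDerivAt.const_mul _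
  · exact ((EuclideanSpace.proj i : EuclideanSpace ℝ (Fin N) →L[ℝ] ℝ).hasFDerivAt.comp p
      ((hρ (e α)).hasFDerivAt.comp p hasFDerivAt_fst))

theorem dX_bvAction {p : Even N r} (hρ : ∀ a, DifferentiableAt ℝ (ρ a) p.1)
    (hS₀ : DifferentiableAt ℝ S₀ p.1) (i : Fin N) :
    dX i (bvAction e ρ S₀) p = fderiv ℝ S₀ p.1 (EuclideanSpace.single i 1) • 1 +
      ∑ α, ∑ j, fderiv ℝ (ρ (e α)) p.1 (EuclideanSpace.single i 1) j •
        (gen (Sum.inr α) * gen (Sum.inl j)) := by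
  rw [dX, (hasFDerivAt_bvAction e hρ hS₀).fderiv]
  simp

theorem dGhostStar_bvAction {p : Even N r} (hρ : ∀ a, DifferentiableAt ℝ (ρ a) p.1)
    (hS₀ : DifferentiableAt ℝ S₀ p.1) (γ : Fin r) :
    dGhostStar γ (bvAction e ρ S₀) p = ∑ α, ∑ β, (-(1 / 2) * structureConst e α β γ) •
        (gen (Sum.inr α) * gen (Sum.inr β)) := by
  rw [dGhostStar, (hasFDerivAt_bvAction e hρ hS₀).fderiv]
  simp [Pi.single_apply]

variable (ρ S₀)

theorem dXStar_bvAction (p : Even N r) (i : Fin N) :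
    dXStar i (bvAction e ρ S₀) p = -∑ α, ρ (e α) p.1 i • gen (Sum.inr α) := by
  rw [dXStar, bvAction_apply]
  simp [leftDeriv_gen_mul, leftDeriv_gen, leftDeriv_one]

theorem structureConst_swap (α β γ : Fin r) :
    structureConst e α β γ = -structureConst e β α γ := by
  rw [structureConst, structureConst, ← lie_skew, map_neg, Finsupp.neg_apply]

theorem dGhost_bvAction (p : Even N r) (α : Fin r) :
    dGhost α (bvAction e ρ S₀) p =
      (∑ i, ρ (e α) p.1 i • gen (Sum.inl i)) -
        ∑ β, ∑ γ, (structureConst e α β γ * p.2 γ) • gen (Sum.inr β) := by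
  rw [dGhost, bvAction_apply]
  have h1 : ∀ a b, leftDeriv (Sum.inr α) (gen (Sum.inr a) * gen (Sum.inr b) :
      Grassmann (Fin N ⊕ Fin r)) =
      (if a = α then gen (Sum.inr b) else 0) - if b = α then gen (Sum.inr a) else 0 := by
    simp [leftDeriv_gen_mul, leftDeriv_gen]
  have h2 : ∀ a i, leftDeriv (Sum.inr α) (gen (Sum.inr a) * gen (Sum.inl i) :
      Grassmann (Fin N ⊕ Fin r)) = if a = α then gen (Sum.inl i) else 0 := by
    simp [leftDeriv_gen_mul, leftDeriv_gen]
  simp only [map_add, map_sum, leftDeriv_real_smul, h1, h2, leftDeriv_one, smul_sub, smul_ite,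
    smul_zero, Finset.sum_sub_distrib, Finset.sum_ite_irrel, Finset.sum_const_zero,
    Finset.sum_ite_eq', Finset.mem_univ, if_true, zero_add]
  rw [add_comm, sub_eq_add_neg (∑ i, ρ (e α) p.1 i • gen (Sum.inl i))]
  congr 1
  simp only [← Finset.sum_neg_distrib, ← Finset.sum_sub_distrib]
  refine Finset.sum_congr rfl fun β _ => Finset.sum_congr rfl fun γ _ => ?_
  rw [structureConst_swap e β α γ]
  module

/-! ### Unimodularity, the Jacobi identity and volume preservation -/

theorem sum_structureConst_smul (α β : Fin r) :
    ∑ γ, structureConst e α β γ • e γ = ⁅e α, e β⁆ := e.sum_repr _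

/-- The trace of `ad` in terms of the structure constants. -/
theorem trace_ad_basis (β : Fin r) :
    LinearMap.trace ℝ g (LieAlgebra.ad ℝ g (e β)) = ∑ γ, structureConst e β γ γ := by
  rw [LinearMap.trace_eq_matrix_trace ℝ e, Matrix.trace]
  simp [LinearMap.toMatrix_apply, structureConst]

/-- The Jacobi identity in terms of the structure constants. -/
theorem structureConst_jacobi (α β δ ε : Fin r) :
    ∑ γ, (structureConst e α β γ * structureConst e γ δ ε +
      structureConst e β δ γ * structureConst e γ α ε +
      structureConst e δ α γ * structureConst e γ β ε) = 0 := by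
  have h : ∀ α β δ, ∑ γ, structureConst e α β γ * structureConst e γ δ ε =
      e.repr ⁅⁅e α, e β⁆, e δ⁆ ε := by
    intro α β δ
    rw [← sum_structureConst_smul e α β, sum_lie, map_sum, Finsupp.finsetSum_apply]
    simp [structureConst]
  rw [Finset.sum_add_distrib, Finset.sum_add_distrib, h, h, h, ← Finsupp.add_apply,
    ← Finsupp.add_apply, ← map_add, ← map_add]
  have h0 : ⁅⁅e α, e β⁆, e δ⁆ + ⁅⁅e β, e δ⁆, e α⁆ + ⁅⁅e δ, e α⁆, e β⁆ = 0 := by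
    have hs : ∀ x y z : g, ⁅⁅x, y⁆, z⁆ = -⁅z, ⁅x, y⁆⁆ := fun x y z => (lie_skew _ _).symm
    rw [hs, hs (e β), hs (e δ), ← neg_zero, ← lie_jacobi (e α) (e β) (e δ)]
    abel
  rw [h0, map_zero, Finsupp.zero_apply]

/-- A vector field preserving `dx^1 ∧ ⋯ ∧ dx^N` is divergence free. -/
theorem PreservesLebesgue.div_eq_zero {U : Set (EuclideanSpace ℝ (Fin N))}
    {V : EuclideanSpace ℝ (Fin N) → EuclideanSpace ℝ (Fin N)} (h : PreservesLebesgue U V)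
    {x : EuclideanSpace ℝ (Fin N)} (hx : x ∈ U) :
    ∑ i, fderiv ℝ V x (EuclideanSpace.single i 1) i = 0 := by
  -- Evaluated on the standard basis, the `j`-th summand of the Lie derivative is the determinant of
  -- the identity matrix with `j`-th column replaced by `∂V/∂x^j`, i.e. `∂V^j/∂x^j`.
  have h1 := h x hx (EuclideanSpace.basisFun (Fin N) ℝ).toBasis
  simp only [lieDerivForm, lebesgueForm, fderiv_fun_const, Pi.zero_apply, zero_apply,
    zero_add] at h1
  rw [← h1]
  refine Finset.sum_congr rfl fun i _ => ?_
  rw [Module.Basis.det_apply, Module.Basis.toMatrix_update, Module.Basis.toMatrix_self,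
    ← Matrix.cramer_apply, Matrix.cramer_one]
  simp

/-! ### The master equation -/

variable {e ρ S₀}

/-- The BV action is `Δ`-closed: the two contributions to `ΔS` are the divergences of the fields
`ρ_α` and the traces of the operators `ad e_α`. -/
theorem laplacian_bvAction {p : Even N r} (hρ : ∀ a, DifferentiableAt ℝ (ρ a) p.1)
    (hS₀ : DifferentiableAt ℝ S₀ p.1)
    (hdiv : ∀ a, ∑ i, fderiv ℝ (ρ a) p.1 (EuclideanSpace.single i 1) i = 0)
    (huni : IsUnimodular g) : laplacian (bvAction e ρ S₀) p = 0 := by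
  have hx : ∀ i, dX i (dXStar i (bvAction e ρ S₀)) p =
      -∑ α, fderiv ℝ (ρ (e α)) p.1 (EuclideanSpace.single i 1) i • gen (Sum.inr α) := by
    intro i
    have h1 : HasFDerivAt (dXStar i (bvAction e ρ S₀))
        (-∑ α, ((EuclideanSpace.proj i).comp
          ((fderiv ℝ (ρ (e α)) p.1).comp (.fst ℝ _ _)) : Even N r →L[ℝ] ℝ).smulRight
          (gen (Sum.inr α))) p := by
      rw [funext fun p => dXStar_bvAction e ρ S₀ p i]
      refine (HasFDerivAt.fun_sum fun α _ => HasFDerivAt.smul_const ?_ _).fun_neg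
      exact ((EuclideanSpace.proj i : EuclideanSpace ℝ (Fin N) →L[ℝ] ℝ).hasFDerivAt.comp p
        ((hρ (e α)).hasFDerivAt.comp p hasFDerivAt_fst))
    rw [dX, h1.fderiv]
    simp
  have hc : ∀ γ, dGhost γ (dGhostStar γ (bvAction e ρ S₀)) p =
      ∑ β, structureConst e β γ γ • gen (Sum.inr β) := by
    intro γ
    have h1 : ∀ a b, leftDeriv (Sum.inr γ) (gen (Sum.inr a) * gen (Sum.inr b) :
        Grassmann (Fin N ⊕ Fin r)) =
        (if a = γ then gen (Sum.inr b) else 0) - if b = γ then gen (Sum.inr a) else 0 := by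
      simp [leftDeriv_gen_mul, leftDeriv_gen]
    rw [dGhost, dGhostStar_bvAction e hρ hS₀]
    simp only [map_sum, leftDeriv_real_smul, h1, smul_sub, smul_ite,
      smul_zero, Finset.sum_sub_distrib, Finset.sum_ite_irrel, Finset.sum_const_zero,
      Finset.sum_ite_eq', Finset.mem_univ, if_true]
    rw [← Finset.sum_sub_distrib]
    refine Finset.sum_congr rfl fun β _ => ?_
    rw [structureConst_swap e γ β γ]
    module
  simp only [laplacian, Pi.sub_apply, Finset.sum_apply, hx, hc, Finset.sum_neg_distrib]
  rw [Finset.sum_comm, Finset.sum_comm (f := fun γ β => structureConst e β γ γ • _)]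
  simp only [← Finset.sum_smul, hdiv, ← trace_ad_basis, huni (e _), zero_smul,
    Finset.sum_const_zero, neg_zero, sub_zero]

theorem sum_smul_ghost_swap (f : Fin r → Fin r → ℝ) :
    ∑ α, ∑ β, f β α • (gen (Sum.inr α) * gen (Sum.inr β) : Grassmann (Fin N ⊕ Fin r)) =
      -∑ α, ∑ β, f α β • (gen (Sum.inr α) * gen (Sum.inr β)) := by
  rw [Finset.sum_comm, ← Finset.sum_neg_distrib]
  refine Finset.sum_congr rfl fun α _ => ?_
  rw [← Finset.sum_neg_distrib]
  refine Finset.sum_congr rfl fun β _ => ?_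
  rw [gen_mul_gen, smul_neg]

/-- The Jacobi identity contracted with three ghosts: the product of the ghosts is invariant under
cyclic permutations, so the sum is a third of the sum of its cyclic permutations. -/
theorem sum_jacobi_smul_ghost (ε : Fin r) :
    ∑ α, ∑ β, ∑ δ, (∑ γ, structureConst e α β γ * structureConst e γ δ ε) •
      (gen (Sum.inr α) * gen (Sum.inr β) * gen (Sum.inr δ) : Grassmann (Fin N ⊕ Fin r)) = 0 := by
  have hcyc : ∀ T : Fin r → Fin r → Fin r → Grassmann (Fin N ⊕ Fin r),
      ∑ α, ∑ β, ∑ δ, T α β δ = ∑ α, ∑ β, ∑ δ, T β δ α := by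
    intro T
    rw [Finset.sum_comm (f := fun α β => ∑ δ, T β δ α)]
    refine Finset.sum_congr rfl fun α _ => ?_
    rw [Finset.sum_comm (f := fun β δ => T α δ β)]
  have hgen : ∀ α β δ : Fin r,
      (gen (Sum.inr β) * gen (Sum.inr δ) * gen (Sum.inr α) : Grassmann (Fin N ⊕ Fin r)) =
        gen (Sum.inr α) * gen (Sum.inr β) * gen (Sum.inr δ) := by
    intro α β δ
    rw [← (mem_evenCenter.1 (gen_mul_gen_mem_evenCenter (Sum.inr β) (Sum.inr δ))).1, mul_assoc]
  have h1 := hcyc fun α β δ => (∑ γ, structureConst e α β γ * structureConst e γ δ ε) •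
      (gen (Sum.inr α) * gen (Sum.inr β) * gen (Sum.inr δ) : Grassmann (Fin N ⊕ Fin r))
  have h2 := h1.trans (hcyc _)
  simp only [hgen] at h1 h2
  have h3 : (3 : ℝ) • (∑ α, ∑ β, ∑ δ,
      (∑ γ, structureConst e α β γ * structureConst e γ δ ε) •
        (gen (Sum.inr α) * gen (Sum.inr β) * gen (Sum.inr δ) : Grassmann (Fin N ⊕ Fin r))) = 0 := by
    rw [show (3 : ℝ) = 1 + 1 + 1 by norm_num, add_smul, add_smul, one_smul]
    nth_rewrite 2 [h1]
    nth_rewrite 2 [h2]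
    simp only [← Finset.sum_add_distrib, ← add_smul, structureConst_jacobi, zero_smul,
      Finset.sum_const_zero]
  exact (smul_eq_zero.1 h3).resolve_left (by norm_num)

theorem sum_smul_apply_single {M : Type*} [NormedAddCommGroup M] [NormedSpace ℝ M]
    (L : EuclideanSpace ℝ (Fin N) →L[ℝ] M) (v : EuclideanSpace ℝ (Fin N)) :
    ∑ i, v i • L (EuclideanSpace.single i 1) = L v := by
  conv_rhs => rw [← (EuclideanSpace.basisFun (Fin N) ℝ).sum_repr v]
  simp

/-- The term containing `∂S₀/∂x^i` is `-ρ_α(S₀) c^α`, which vanishes because `S₀` is invariant. -/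
theorem sum_dX_mul_dXStar_bvAction {p : Even N r} (hρ : ∀ a, DifferentiableAt ℝ (ρ a) p.1)
    (hS₀ : DifferentiableAt ℝ S₀ p.1) (hinv : ∀ a, fderiv ℝ S₀ p.1 (ρ a p.1) = 0) :
    ∑ i, dX i (bvAction e ρ S₀) p * dXStar i (bvAction e ρ S₀) p =
      ∑ j, (∑ α, ∑ β, fderiv ℝ (ρ (e α)) p.1 (ρ (e β) p.1) j •
        (gen (Sum.inr α) * gen (Sum.inr β))) * gen (Sum.inl j) := by
  have hf : ∀ α β j, fderiv ℝ (ρ (e α)) p.1 (ρ (e β) p.1) j =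
      ∑ i, ρ (e β) p.1 i * fderiv ℝ (ρ (e α)) p.1 (EuclideanSpace.single i 1) j := by
    intro α β j
    rw [← sum_smul_apply_single (fderiv ℝ (ρ (e α)) p.1)]
    simp
  have hg : ∀ (α β : Fin r) (j : Fin N), (gen (Sum.inr α) * gen (Sum.inl j) * gen (Sum.inr β) :
      Grassmann (Fin N ⊕ Fin r)) = -(gen (Sum.inr α) * gen (Sum.inr β) * gen (Sum.inl j)) := by
    intro α β j
    rw [mul_assoc, gen_mul_gen, mul_neg, mul_assoc]
  have h0 : ∑ i, ∑ β, (ρ (e β) p.1 i * fderiv ℝ S₀ p.1 (EuclideanSpace.single i 1)) •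
      (gen (Sum.inr β) : Grassmann (Fin N ⊕ Fin r)) = 0 := by
    rw [Finset.sum_comm]
    refine Finset.sum_eq_zero fun β _ => ?_
    rw [← Finset.sum_smul,
      show ∑ i, ρ (e β) p.1 i * fderiv ℝ S₀ p.1 (EuclideanSpace.single i 1) = 0 from
        (sum_smul_apply_single (fderiv ℝ S₀ p.1) _).trans (hinv _), zero_smul]
  have hcomm : ∀ T : Fin N → Fin r → Fin r → Fin N → Grassmann (Fin N ⊕ Fin r),
      ∑ i, ∑ β, ∑ α, ∑ j, T i β α j = ∑ j, ∑ α, ∑ β, ∑ i, T i β α j := by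
    intro T
    have h1 : ∀ i, ∑ β, ∑ α, ∑ j, T i β α j = ∑ j, ∑ α, ∑ β, T i β α j := fun i =>
      Finset.sum_comm.trans
        ((Finset.sum_congr rfl fun α _ => Finset.sum_comm).trans Finset.sum_comm)
    simp only [h1]
    exact Finset.sum_comm.trans (Finset.sum_congr rfl fun j _ =>
      Finset.sum_comm.trans (Finset.sum_congr rfl fun α _ => Finset.sum_comm))
  simp only [dX_bvAction e hρ hS₀, dXStar_bvAction, mul_neg, add_mul,
    Finset.sum_neg_distrib, Finset.sum_add_distrib]
  simp only [Finset.mul_sum, Finset.sum_mul, mul_smul_comm, hg, smul_mul_assoc, one_mul, hf,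
    smul_neg, Finset.sum_neg_distrib, neg_add, neg_neg, Finset.sum_smul, Finset.smul_sum, smul_smul]
  rw [h0, neg_zero, zero_add, hcomm]

/-- The term cubic in the ghosts vanishes by the Jacobi identity. In the other one
`∑ γ, C_{αβ}^γ ρ_γ` is the commutator of `ρ_α` and `ρ_β`, whose two halves contribute equally. -/
theorem sum_dGhostStar_mul_dGhost_bvAction {p : Even N r}
    (hρ : ∀ a, DifferentiableAt ℝ (ρ a) p.1)
    (hS₀ : DifferentiableAt ℝ S₀ p.1)
    (hlie : ∀ a b, ρ ⁅a, b⁆ p.1 = VectorField.lieBracket ℝ (ρ a) (ρ b) p.1) :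
    ∑ γ, dGhostStar γ (bvAction e ρ S₀) p * dGhost γ (bvAction e ρ S₀) p =
      ∑ j, (∑ α, ∑ β, fderiv ℝ (ρ (e α)) p.1 (ρ (e β) p.1) j •
        (gen (Sum.inr α) * gen (Sum.inr β))) * gen (Sum.inl j) := by
  have hf : ∀ α β j, ∑ γ, structureConst e α β γ * ρ (e γ) p.1 j =
      fderiv ℝ (ρ (e β)) p.1 (ρ (e α) p.1) j - fderiv ℝ (ρ (e α)) p.1 (ρ (e β) p.1) j := by
    intro α β j
    have h := congrArg (fun v => v j) (hlie (e α) (e β))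
    rw [← sum_structureConst_smul, map_sum] at h
    simpa [VectorField.lieBracket_eq] using h
  have h1 : ∑ γ, dGhostStar γ (bvAction e ρ S₀) p *
      (∑ j, ρ (e γ) p.1 j • gen (Sum.inl j)) =
      ∑ j, (∑ α, ∑ β, fderiv ℝ (ρ (e α)) p.1 (ρ (e β) p.1) j •
        (gen (Sum.inr α) * gen (Sum.inr β))) * gen (Sum.inl j) := by
    simp only [Finset.mul_sum]
    rw [Finset.sum_comm]
    refine Finset.sum_congr rfl fun j _ => ?_
    simp only [mul_smul_comm, ← smul_mul_assoc, ← Finset.sum_mul]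
    congr 1
    have h2 : ∀ γ, ρ (e γ) p.1 j • dGhostStar γ (bvAction e ρ S₀) p =
        ∑ α, ∑ β, (-(1 / 2) * (structureConst e α β γ * ρ (e γ) p.1 j)) •
          (gen (Sum.inr α) * gen (Sum.inr β)) := by
      intro γ
      simp only [dGhostStar_bvAction e hρ hS₀, Finset.smul_sum, smul_smul]
      refine Finset.sum_congr rfl fun α _ => Finset.sum_congr rfl fun β _ => ?_
      congr 1
      ring
    simp only [h2]
    rw [Finset.sum_comm]
    simp only [fun α : Fin r => Finset.sum_comm (s := Finset.univ) (t := Finset.univ)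
      (f := fun γ β => (-(1 / 2) * (structureConst e α β γ * ρ (e γ) p.1 j)) •
          (gen (Sum.inr α) * gen (Sum.inr β) : Grassmann (Fin N ⊕ Fin r))),
      ← Finset.sum_smul, ← Finset.mul_sum, hf]
    simp only [mul_sub, sub_smul, Finset.sum_sub_distrib, mul_smul, ← Finset.smul_sum]
    rw [sum_smul_ghost_swap fun α β => fderiv ℝ (ρ (e α)) p.1 (ρ (e β) p.1) j]
    simp only [smul_mul_assoc]
    module
  have h2 : ∑ γ, dGhostStar γ (bvAction e ρ S₀) p *
      (∑ δ, ∑ ε, (structureConst e γ δ ε * p.2 ε) • gen (Sum.inr δ)) =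
      ∑ ε, (-(1 / 2) * p.2 ε) • ∑ α, ∑ β, ∑ δ,
        (∑ γ, structureConst e α β γ * structureConst e γ δ ε) •
        (gen (Sum.inr α) * gen (Sum.inr β) * gen (Sum.inr δ)) := by
    have hcomm : ∀ T : Fin r → Fin r → Fin r → Fin r → Fin r → Grassmann (Fin N ⊕ Fin r),
        ∑ γ, ∑ δ, ∑ ε, ∑ α, ∑ β, T γ δ ε α β = ∑ ε, ∑ α, ∑ β, ∑ δ, ∑ γ, T γ δ ε α β := by
      intro T
      calc ∑ γ, ∑ δ, ∑ ε, ∑ α, ∑ β, T γ δ ε α β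
          = ∑ δ, ∑ ε, ∑ γ, ∑ α, ∑ β, T γ δ ε α β :=
            Finset.sum_comm.trans (Finset.sum_congr rfl fun δ _ => Finset.sum_comm)
        _ = ∑ ε, ∑ δ, ∑ α, ∑ β, ∑ γ, T γ δ ε α β :=
            Finset.sum_comm.trans (Finset.sum_congr rfl fun ε _ => Finset.sum_congr rfl fun δ _ =>
              Finset.sum_comm.trans (Finset.sum_congr rfl fun α _ => Finset.sum_comm))
        _ = ∑ ε, ∑ α, ∑ β, ∑ δ, ∑ γ, T γ δ ε α β :=
            Finset.sum_congr rfl fun ε _ =>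
              Finset.sum_comm.trans (Finset.sum_congr rfl fun α _ => Finset.sum_comm)
    simp only [dGhostStar_bvAction e hρ hS₀, Finset.mul_sum, Finset.sum_mul, Finset.smul_sum,
      Finset.sum_smul, smul_mul_smul_comm, smul_smul]
    rw [hcomm]
    refine Finset.sum_congr rfl fun ε _ => Finset.sum_congr rfl fun α _ =>
      Finset.sum_congr rfl fun β _ => Finset.sum_congr rfl fun δ _ =>
      Finset.sum_congr rfl fun γ _ => ?_
    congr 1
    ring
  simp only [dGhost_bvAction, mul_sub, Finset.sum_sub_distrib, h1, h2, sum_jacobi_smul_ghost,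
    smul_zero, Finset.sum_const_zero, sub_zero]

/-- The classical master equation `{S, S} = 0`. -/
theorem bracket_bvAction {p : Even N r} (hρ : ∀ a, DifferentiableAt ℝ (ρ a) p.1)
    (hS₀ : DifferentiableAt ℝ S₀ p.1) (hinv : ∀ a, fderiv ℝ S₀ p.1 (ρ a p.1) = 0)
    (hlie : ∀ a b, ρ ⁅a, b⁆ p.1 = VectorField.lieBracket ℝ (ρ a) (ρ b) p.1) :
    bracket (bvAction e ρ S₀) (bvAction e ρ S₀) p = 0 := by
  rw [bracket_self (bvAction_mem_evenCenter e ρ S₀)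
    (hasFDerivAt_bvAction e hρ hS₀).differentiableAt, sum_dX_mul_dXStar_bvAction hρ hS₀ hinv,
    sum_dGhostStar_mul_dGhost_bvAction hρ hS₀ hlie, sub_self, smul_zero]

end Action

end BV

theorem mainTheorem5 {N r : ℕ} {g : Type*} [LieRing g] [LieAlgebra ℝ g]
    (e : Module.Basis (Fin r) ℝ g)
    (U : Set (EuclideanSpace ℝ (Fin N))) (hU : IsOpen U)
    (ρ : g →ₗ[ℝ] (EuclideanSpace ℝ (Fin N) → EuclideanSpace ℝ (Fin N)))
    (hρ : BV.IsLieAction U ρ)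
    (S₀ : EuclideanSpace ℝ (Fin N) → ℝ) (hS₀ : ContDiffOn ℝ (⊤ : ℕ∞) S₀ U)
    (hinv : ∀ a, ∀ x ∈ U, fderiv ℝ S₀ x (ρ a x) = 0)
    (hvol : ∀ a, BV.PreservesLebesgue U (ρ a))
    (huni : BV.IsUnimodular g)
    (hbar : ℝ) (hhbar : hbar ≠ 0) :
    (BV.IsSmoothSuperFun U (BV.bvAction e ρ S₀) ∧
      BV.IsSmoothSuperFun U (BV.expI hbar (BV.bvAction e ρ S₀))) ∧
    BV.IsLaplacianClosed U (BV.bvAction e ρ S₀) ∧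
    BV.QuantumMasterEquation U hbar (BV.bvAction e ρ S₀) ∧
    BV.IsLaplacianClosed U (BV.expI hbar (BV.bvAction e ρ S₀)) := by
  have hS := BV.isSmoothSuperFun_bvAction e hρ hS₀
  have hdρ : ∀ p ∈ BV.region U r, ∀ a, DifferentiableAt ℝ (ρ a) p.1 := fun p hp a =>
    ((hρ.smooth a).contDiffAt (hU.mem_nhds hp.1)).differentiableAt (by simp)
  have hdS₀ : ∀ p ∈ BV.region U r, DifferentiableAt ℝ S₀ p.1 := fun p hp =>
    (hS₀.contDiffAt (hU.mem_nhds hp.1)).differentiableAt (by simp)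
  have hΔ : ∀ p ∈ BV.region U r, BV.laplacian (BV.bvAction e ρ S₀) p = 0 := fun p hp =>
    BV.laplacian_bvAction (hdρ p hp) (hdS₀ p hp) (fun a => (hvol a).div_eq_zero hp.1) huni
  have hb : ∀ p ∈ BV.region U r, BV.bracket (BV.bvAction e ρ S₀) (BV.bvAction e ρ S₀) p = 0 :=
    fun p hp => BV.bracket_bvAction (hdρ p hp) (hdS₀ p hp) (fun a => hinv a _ hp.1)
      (fun a b => hρ.map_lie a b _ hp.1)
  refine ⟨⟨hS, BV.isSmoothSuperFun_expI hS hbar⟩, hΔ, fun p hp => ?_, fun p hp => ?_⟩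
  · rw [hb p hp, hΔ p hp, smul_zero, sub_zero]
  · exact BV.laplacian_expI_eq_zero (BV.bvAction_mem_evenCenter e ρ S₀)
      (BV.hasFDerivAt_bvAction e (hdρ p hp) (hdS₀ p hp)).differentiableAt (hΔ p hp) (hb p hp) hbar
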